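/- Let $\mathcal A$ be a unital $C^*$-algebra and let $H_{\mathcal A}$ be the standard Hilbert $\mathcal A$-module, i.e. the module of all sequences $(x_n)_{n\in\mathbb N}$ in $\mathcal A$ for which $\sum_n\langle x_n,x_n\rangle$ converges in norm, with inner product $\langle x,y\rangle=\sum_n\langle x_n,y_n\rangle$, where $\langle a,b\rangle=ba^*$ for $a,b\in\mathcal A$ (modules are written as left modules). Let $F$ be a bounded adjointable $\mathcal A$-linear operator on $H_{\mathcal A}$. An $\mathcal M\Phi_+$ decomposition for $F$ consists of closed submodules $M_1,N_1,M_2,N_2$ of $H_{\mathcal A}$ such that $N_1$ is finitely generated, $H_{\mathcal A}=M_1\tilde\oplus N_1=M_2\tilde\oplus N_2$ (direct, not necessarily orthogonal, sums), $F(M_1)\subseteq M_2$, $F(N_1)\subseteq N_2$, and the restriction $F|_{M_1}:M_1\to M_2$ is an isomorphism. The operator $F$ belongs to $\mathcal M\Phi_+(H_{\mathcal A})$ if it has an $\mathcal M\Phi_+$ decomposition. Let $K(\mathcal A)$ be the Grothendieck group of the monoid, under direct sum, of isomorphism classes of finitely generated projective $\mathcal A$-modules, and write $[N]$ for the class of such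 a module $N$. Lemma 2.20. Let $F\in\mathcal M\Phi_+(H_{\mathcal A})$ and suppose that $\operatorname{ran}F$ is closed. If $$H_{\mathcal A}=M_1\tilde\oplus N_1\xrightarrow{\;F\;}M_2\tilde\oplus N_2=H_{\mathcal A},\qquad H_{\mathcal A}=M_1'\tilde\oplus N_1'\xrightarrow{\;F\;}M_2'\tilde\oplus N_2'=H_{\mathcal A}$$ are two $\mathcal M\Phi_+$ decompositions for $F$, then $F(N_1)$ and $F(N_1')$ are closed, finitely generated and projective $\mathcal A$-modules, $N_1$ and $N_1'$ are finitely generated and projective as well, and $$[N_1]-[F(N_1)]=[N_1']-[F(N_1')]\quad\text{in }K(\mathcal A).$$ -/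

import Mathlib

universe u

namespace HilbertModule

open scoped InnerProductSpace

/-! ### The standard module `H_A` over a unital C⋆-algebra -/

section StandardModule

variable {A : Type u} [CStarAlgebra A] [PartialOrder A] [StarOrderedRing A]

/-- The Cauchy-Schwarz inequality for finite sums in `A`. -/
theorem norm_sum_mul_star_le (x y : ℕ → A) (t : Finset ℕ) :
    ‖∑ n ∈ t, y n * star (x n)‖ ≤
      √‖∑ n ∈ t, x n * star (x n)‖ * √‖∑ n ∈ t, y n * star (y n)‖ := by
  have h := CStarModule.norm_inner_le (A := A) (WithCStarModule A ((i : t) → A))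
    (x := (WithCStarModule.equiv A ((i : t) → A)).symm fun i => x i)
    (y := (WithCStarModule.equiv A ((i : t) → A)).symm fun i => y i)
  simp only [WithCStarModule.pi_norm, WithCStarModule.pi_inner,
    WithCStarModule.equiv_symm_pi_apply, WithCStarModule.inner_def] at h
  rw [Finset.sum_coe_sort t (fun n => y n * star (x n)),
    Finset.sum_coe_sort t (fun n => x n * star (x n)),
    Finset.sum_coe_sort t (fun n => y n * star (y n))] at h
  exact h

theorem summable_mul_star {x y : ℕ → A} (hx : Summable fun n => x n * star (x n))
    (hy : Summable fun n => y n * star (y n)) : Summable fun n => y n * star (x n) := by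
  rw [summable_iff_vanishing_norm] at hx hy ⊢
  intro ε hε
  obtain ⟨s, hs⟩ := hx ε hε
  obtain ⟨s', hs'⟩ := hy ε hε
  refine ⟨s ∪ s', fun t ht => ?_⟩
  rw [Finset.disjoint_union_right] at ht
  have h1 := Real.sqrt_lt_sqrt (norm_nonneg _) (hs t ht.1)
  have h2 := Real.sqrt_lt_sqrt (norm_nonneg _) (hs' t ht.2)
  calc _ ≤ _ := norm_sum_mul_star_le x y t
    _ < √ε * √ε := mul_lt_mul'' h1 h2 (Real.sqrt_nonneg _) (Real.sqrt_nonneg _)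
    _ = ε := Real.mul_self_sqrt hε.le

variable (A) in
/-- The sequences `(xₙ)` in `A` for which `∑ xₙ xₙ⋆` converges in norm. -/
def squareSummable : Submodule A (ℕ → A) where
  carrier := {x | Summable fun n => x n * star (x n)}
  zero_mem' := by simp [summable_zero]
  add_mem' {x y} hx hy := by
    have h := ((show Summable fun n => x n * star (x n) from hx).add (summable_mul_star hy hx)).add
      ((summable_mul_star hx hy).add (show Summable fun n => y n * star (y n) from hy))
    refine h.congr fun n => ?_
    simp only [Pi.add_apply, star_add]
    noncomm_ring
  smul_mem' a x hx := by
    have h := ((show Summable fun n => x n * star (x n) from hx).mul_left a).mul_right (star a)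
    refine h.congr fun n => ?_
    simp [mul_assoc]

variable (A) in
/-- The standard module `H_A`: the Hilbert C⋆-module of all sequences `(xₙ)` in `A` for which
`∑ xₙ xₙ⋆` converges in norm, with the inner product `⟪x, y⟫ = ∑ yₙ xₙ⋆`
(Mathlib's convention: left modules, inner product linear in the second variable). -/
def StandardModule : Type u := squareSummable A

namespace StandardModule

noncomputable instance : AddCommGroup (StandardModule A) :=
  inferInstanceAs (AddCommGroup (squareSummable A))

noncomputable instance : Module A (StandardModule A) :=
  inferInstanceAs (Module A (squareSummable A))

noncomputable instance : Module ℂ (StandardModule A) :=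
  inferInstanceAs (Module ℂ (squareSummable A))

instance : IsScalarTower ℂ A (StandardModule A) :=
  inferInstanceAs (IsScalarTower ℂ A (squareSummable A))

instance : CoeFun (StandardModule A) (fun _ => ℕ → A) := ⟨fun x => x.1⟩

theorem summable (x y : StandardModule A) : Summable fun n => y n * star (x n) :=
  summable_mul_star x.2 y.2

noncomputable instance : Norm (StandardModule A) :=
  ⟨fun x => √‖∑' n, x n * star (x n)‖⟩

noncomputable instance : CStarModule A (StandardModule A) where
  inner x y := ∑' n, y n * star (x n)
  inner_add_right {x y z} := by
    rw [← (summable x y).tsum_add (summable x z)]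
    exact tsum_congr fun n => add_mul _ _ _
  inner_self_nonneg {x} := tsum_nonneg fun n => mul_star_self_nonneg _
  inner_self {x} := by
    constructor
    · intro h
      have h0 := (hasSum_zero_iff_of_nonneg fun n => mul_star_self_nonneg (x n)).1
        (h ▸ (summable x x).hasSum)
      refine Subtype.ext (funext fun n => ?_)
      exact CStarRing.mul_star_self_eq_zero_iff _ |>.1 (congrFun h0 n)
    · rintro rfl
      have : ∀ n, (0 : StandardModule A) n = 0 := fun n => rfl
      simp [this]
  inner_op_smul_right {a x y} := by
    rw [← (summable x y).tsum_mul_left a]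
    exact tsum_congr fun n => mul_assoc _ _ _
  inner_smul_right_complex {z x y} := by
    rw [← (summable x y).tsum_const_smul z]
    exact tsum_congr fun n => smul_mul_assoc _ _ _
  star_inner x y := by
    rw [tsum_star]
    exact tsum_congr fun n => by simp
  norm_eq_sqrt_norm_inner_self _ := rfl

noncomputable instance : NormedAddCommGroup (StandardModule A) :=
  CStarModule.normedAddCommGroup A

noncomputable instance : NormedSpace ℂ (StandardModule A) :=
  NormedSpace.ofCore (CStarModule.normedSpaceCore A)

end StandardModule

end StandardModule

/-! ### The `K`-group of finitely generated projective modules -/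

section KGroup

/-- `M` is a finitely generated projective `A`-module. -/
structure IsFGProjective (A : Type u) [Ring A] (M : Type u) [AddCommGroup M] [Module A M] :
    Prop where
  finite : Module.Finite A M
  projective : Module.Projective A M

variable (A : Type u) [Ring A]

/-- A bundled finitely generated projective `A`-module. -/
structure FGProjModule where
  carrier : Type u
  [addCommGroup : AddCommGroup carrier]
  [module : Module A carrier]
  [finite : Module.Finite A carrier]
  [projective : Module.Projective A carrier]

attribute [instance] FGProjModule.addCommGroup FGProjModule.module FGProjModule.finite
  FGProjModule.projective

/-- Isomorphism of finitely generated projective modules. -/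
instance FGProjModule.setoid : Setoid (FGProjModule A) where
  r P Q := Nonempty (P.carrier ≃ₗ[A] Q.carrier)
  iseqv := ⟨fun _ => ⟨LinearEquiv.refl A _⟩, fun ⟨e⟩ => ⟨e.symm⟩, fun ⟨e⟩ ⟨f⟩ => ⟨e.trans f⟩⟩

/-- Isomorphism classes of finitely generated projective `A`-modules. -/
def FGProjClass : Type (u + 1) := Quotient (FGProjModule.setoid A)

variable {A} in
/-- The isomorphism class of a finitely generated projective module. -/
def FGProjClass.mk (P : FGProjModule A) : FGProjClass A := Quotient.mk _ P

variable {A} in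
/-- The direct sum of two finitely generated projective modules. -/
def FGProjModule.prod (P Q : FGProjModule A) : FGProjModule A where
  carrier := P.carrier × Q.carrier

instance : Add (FGProjClass A) :=
  ⟨Quotient.map₂ FGProjModule.prod (fun _ _ ⟨e⟩ _ _ ⟨f⟩ => ⟨LinearEquiv.prodCongr e f⟩)⟩

instance : Zero (FGProjClass A) :=
  ⟨FGProjClass.mk { carrier := PUnit.{u + 1} }⟩

/-- Isomorphism classes form a commutative monoid under the direct sum. -/
instance FGProjClass.addCommMonoid : AddCommMonoid (FGProjClass A) where
  add_assoc := by
    rintro ⟨P⟩ ⟨Q⟩ ⟨R⟩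
    exact Quotient.sound ⟨LinearEquiv.prodAssoc A P.carrier Q.carrier R.carrier⟩
  zero_add := by
    rintro ⟨P⟩
    exact Quotient.sound ⟨LinearEquiv.uniqueProd⟩
  add_zero := by
    rintro ⟨P⟩
    exact Quotient.sound ⟨LinearEquiv.prodUnique⟩
  add_comm := by
    rintro ⟨P⟩ ⟨Q⟩
    exact Quotient.sound ⟨LinearEquiv.prodComm A P.carrier Q.carrier⟩
  nsmul := nsmulRec

/-- `K(A)`: the Grothendieck group of the monoid of isomorphism classes of finitely generated
projective `A`-modules. -/
abbrev KGroup : Type (u + 1) := Algebra.GrothendieckAddGroup (FGProjClass A)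

variable {A} in
/-- The class `[M]` in `K(A)` of a finitely generated projective `A`-module `M`. -/
def KGroup.mk {M : Type u} [AddCommGroup M] [Module A M] (h : IsFGProjective A M) : KGroup A :=
  Algebra.GrothendieckAddGroup.of (FGProjClass.mk
    { carrier := M, finite := h.finite, projective := h.projective })

end KGroup

/-! ### Upper semi-Fredholm operators on `H_A` -/

section SemiFredholm

variable {A : Type u} [CStarAlgebra A] [PartialOrder A] [StarOrderedRing A]

/-- `F` is adjointable: there is an operator `G` with `⟪F x, y⟫ = ⟪x, G y⟫` for all `x`, `y`. -/
def IsAdjointable (F : StandardModule A →L[A] StandardModule A) : Prop :=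
  ∃ G : StandardModule A →L[A] StandardModule A,
    ∀ x y : StandardModule A, ⟪F x, y⟫_A = ⟪x, G y⟫_A

/-- `H_A = M₁ ⊕ N₁ → M₂ ⊕ N₂ = H_A` is an upper semi-Fredholm decomposition for `F`: the sums are
direct (not necessarily orthogonal), all four submodules are closed, `F` is diagonal with respect
to the decompositions, its corner `M₁ → M₂` is an isomorphism and `N₁` is finitely generated. -/
structure IsUpperDecomposition (F : StandardModule A →L[A] StandardModule A)
    (M₁ N₁ M₂ N₂ : Submodule A (StandardModule A)) : Prop where
  isClosed_M₁ : IsClosed (M₁ : Set (StandardModule A))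
  isClosed_N₁ : IsClosed (N₁ : Set (StandardModule A))
  isClosed_M₂ : IsClosed (M₂ : Set (StandardModule A))
  isClosed_N₂ : IsClosed (N₂ : Set (StandardModule A))
  isCompl_dom : IsCompl M₁ N₁
  isCompl_cod : IsCompl M₂ N₂
  iso : ∃ e : M₁ ≃L[A] M₂, ∀ x : M₁, ((e x : M₂) : StandardModule A) = F x
  mapsTo : ∀ x ∈ N₁, F x ∈ N₂
  fg : N₁.FG

variable (A) in
/-- The class `MΦ₊(H_A)` of upper semi-`A`-Fredholm operators. -/
def MPhiPlus : Set (StandardModule A →L[A] StandardModule A) :=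
  {F | IsAdjointable F ∧ ∃ M₁ N₁ M₂ N₂, IsUpperDecomposition F M₁ N₁ M₂ N₂}

end SemiFredholm

end HilbertModule

/-! Both differences equal `[ker F]`, which does not depend on the decomposition. If `F x ∈ N₂`,
then the `M₁`-part of `x` is sent into `M₂ ∩ N₂ = 0`, so it vanishes by injectivity of `F` on `M₁`
(`mem_of_apply_mem`). Hence `ker F ⊆ N₁` and `F(N₁) = ran F ∩ N₂`, which is closed. Once `F(N₁)` is
known to be projective, `N₁ → F(N₁)` splits and `N₁ ≅ ker F ⊕ F(N₁)`.

The analytic part is `projective_of_isClosed_of_fg`. For generators `x i` of a closed submodule `N`,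
the frame operator `y ↦ ∑ ⟪x i, y⟫ x i` is invertible on `N`, so `N` is a retract of `Aⁿ`. The open
mapping theorem bounds this operator below, and positivity extends the bound uniformly to its
translates by `t ≥ 0`. Invertibility then descends from large `t` to `t = 0`. Completeness of `H_A`
is what makes the open mapping theorem available. -/

namespace HilbertModule

open scoped InnerProductSpace

/-! ### Completeness of the standard module -/

namespace StandardModule

variable {A : Type u} [CStarAlgebra A] [PartialOrder A] [StarOrderedRing A]

/-- The triangle inequality for the norm of `Aᵗ`, `t` a finite set. -/
theorem sqrt_norm_sum_add_le (x y : ℕ → A) (t : Finset ℕ) :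
    √‖∑ n ∈ t, (x n + y n) * star (x n + y n)‖ ≤
      √‖∑ n ∈ t, x n * star (x n)‖ + √‖∑ n ∈ t, y n * star (y n)‖ := by
  have h := norm_add_le (E := WithCStarModule A ((i : t) → A))
    ((WithCStarModule.equiv A ((i : t) → A)).symm fun i => x i)
    ((WithCStarModule.equiv A ((i : t) → A)).symm fun i => y i)
  simp only [WithCStarModule.pi_norm, WithCStarModule.add_apply,
    WithCStarModule.equiv_symm_pi_apply, WithCStarModule.inner_def] at h
  rw [Finset.sum_coe_sort t (fun n => (x n + y n) * star (x n + y n)),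
    Finset.sum_coe_sort t (fun n => x n * star (x n)),
    Finset.sum_coe_sort t (fun n => y n * star (y n))] at h
  exact h

theorem sqrt_norm_sum_le_norm (x : StandardModule A) (t : Finset ℕ) :
    √‖∑ n ∈ t, x n * star (x n)‖ ≤ ‖x‖ := by
  refine Real.sqrt_le_sqrt (CStarAlgebra.norm_le_norm_of_nonneg_of_le
    (Finset.sum_nonneg fun n _ => mul_star_self_nonneg _) ?_)
  exact (summable x x).sum_le_tsum t fun n _ => mul_star_self_nonneg _

theorem norm_apply_le (x : StandardModule A) (n : ℕ) : ‖x n‖ ≤ ‖x‖ := by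
  simpa [CStarRing.norm_self_mul_star] using sqrt_norm_sum_le_norm x {n}

theorem norm_le_of_forall_sum {x : StandardModule A} {C : ℝ}
    (h : ∀ t : Finset ℕ, √‖∑ n ∈ t, x n * star (x n)‖ ≤ C) : ‖x‖ ≤ C := by
  have h1 := (summable x x).hasSum
  exact le_of_tendsto (h1.norm.sqrt) (Filter.Eventually.of_forall h)

/-- As for `ℓ²`: the limit is taken coordinatewise, and Cauchy estimates on finite partial sums
survive it. -/
instance : CompleteSpace (StandardModule A) := by
  refine Metric.complete_of_cauchySeq_tendsto fun u hu => ?_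
  have hcoord : ∀ n, ∃ a, Filter.Tendsto (fun k => u k n) Filter.atTop (nhds a) := fun n => by
    refine cauchySeq_tendsto_of_complete ?_
    rw [Metric.cauchySeq_iff'] at hu ⊢
    intro ε hε
    obtain ⟨N, hN⟩ := hu ε hε
    refine ⟨N, fun k hk => ?_⟩
    have := hN k hk
    rw [dist_eq_norm] at this ⊢
    exact (norm_apply_le (u k - u N) n).trans_lt this
  choose x hx using hcoord
  -- `N` is chosen before `t`; this uniformity yields both square-summability of the limit and
  -- convergence in norm.
  have key : ∀ ε > 0, ∃ N, ∀ k ≥ N, ∀ t : Finset ℕ,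
      √‖∑ n ∈ t, (x n - u k n) * star (x n - u k n)‖ ≤ ε := by
    intro ε hε
    obtain ⟨N, hN⟩ := Metric.cauchySeq_iff.1 hu ε hε
    refine ⟨N, fun k hk t => ?_⟩
    have hlim : Filter.Tendsto
        (fun m => √‖∑ n ∈ t, (u m n - u k n) * star (u m n - u k n)‖) Filter.atTop
        (nhds √‖∑ n ∈ t, (x n - u k n) * star (x n - u k n)‖) := by
      refine (tendsto_finsetSum t fun n _ => ?_).norm.sqrt
      have := (hx n).sub_const (u k n)
      exact this.mul this.star
    refine le_of_tendsto hlim ?_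
    filter_upwards [Filter.eventually_ge_atTop N] with m hm
    have := hN m hm k hk
    rw [dist_eq_norm] at this
    exact (sqrt_norm_sum_le_norm (u m - u k) t).trans this.le
  have hxs : Summable fun n => x n * star (x n) := by
    rw [summable_iff_vanishing_norm]
    intro ε hε
    have hs : 0 < √ε := Real.sqrt_pos.2 hε
    obtain ⟨N, hN⟩ := key (√ε / 2) (by positivity)
    obtain ⟨s, hs'⟩ := summable_iff_vanishing_norm.1 (summable (u N) (u N)) ((√ε / 2) ^ 2)
      (by positivity)
    refine ⟨s, fun t ht => ?_⟩
    have h1 := sqrt_norm_sum_add_le (fun n => x n - u N n) (u N) t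
    have h2 := (Real.sqrt_lt' (by positivity)).2 (hs' t ht)
    simp only [sub_add_cancel] at h1
    have h3 : √‖∑ n ∈ t, x n * star (x n)‖ < √ε := by linarith [hN N le_rfl t]
    exact (Real.sqrt_lt_sqrt_iff (norm_nonneg _)).1 h3
  let y : StandardModule A := ⟨x, hxs⟩
  refine ⟨y, Metric.tendsto_atTop.2 fun ε hε => ?_⟩
  obtain ⟨N, hN⟩ := key (ε / 2) (by positivity)
  refine ⟨N, fun k hk => ?_⟩
  rw [dist_comm, dist_eq_norm]
  exact (norm_le_of_forall_sum (x := y - u k) (hN k hk)).trans_lt (by linarith)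

end StandardModule

/-! ### Closed finitely generated submodules of Hilbert modules are projective -/

section Projective

/-- A bounded operator `S` such that all `S + t`, `t ≥ 0`, are bounded below by the same constant
is invertible. -/
theorem isUnit_of_forall_add_smul_bounded_below {X : Type*} [NormedAddCommGroup X]
    [NormedSpace ℂ X] [CompleteSpace X] (S : X →L[ℂ] X) {K : ℝ} (hK : 0 < K)
    (h : ∀ t : ℝ, 0 ≤ t → ∀ y, ‖y‖ ≤ K * ‖S y + (t : ℂ) • y‖) : IsUnit S := by
  rcases subsingleton_or_nontrivial X with hX | hX
  · exact ⟨1, Subsingleton.elim _ _⟩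
  have hlarge : ∀ t : ℝ, ‖S‖ < t → IsUnit (S + algebraMap ℂ (X →L[ℂ] X) t) := by
    intro t ht
    have h1 : ‖S‖ < ‖(-t : ℂ)‖ := by
      rw [norm_neg, Complex.norm_real]
      exact ht.trans_le (le_abs_self t)
    have h2 : IsUnit (algebraMap ℂ (X →L[ℂ] X) (-t) - S) := spectrum.mem_resolventSet_of_norm_lt h1
    have h3 := h2.neg
    rwa [map_neg, neg_sub, sub_neg_eq_add] at h3
  -- An inverse of norm at most `K` leaves room for perturbations of norm below `1 / K`, so `t` can
  -- be lowered by half that radius, a step that does not shrink.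
  have hstep : ∀ n : ℕ, ∀ t : ℝ, 0 ≤ t → ‖S‖ + 1 ≤ t + n * (1 / (2 * K)) →
      IsUnit (S + algebraMap ℂ (X →L[ℂ] X) t) := by
    intro n
    induction n with
    | zero => exact fun t _ ht => hlarge t (by simp at ht; linarith)
    | succ n ih =>
      intro t ht0 ht
      have hd : 0 < 1 / (2 * K) := by positivity
      obtain ⟨v, hv⟩ := ih (t + 1 / (2 * K)) (by linarith) (by push_cast at ht; linarith)
      have hvinv : ‖(↑v⁻¹ : X →L[ℂ] X)‖ ≤ K := by
        refine ContinuousLinearMap.opNorm_le_bound _ hK.le fun y => ?_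
        have h1 := h (t + 1 / (2 * K)) (by linarith) ((↑v⁻¹ : X →L[ℂ] X) y)
        have h2 : (v : X →L[ℂ] X) ((↑v⁻¹ : X →L[ℂ] X) y) = y := by
          rw [← mul_apply_eq_comp, Units.mul_inv, one_apply_eq_self]
        rw [hv] at h2
        have h3 : S ((↑v⁻¹ : X →L[ℂ] X) y) +
          ((t + 1 / (2 * K) : ℝ) : ℂ) • ((↑v⁻¹ : X →L[ℂ] X) y) = y := h2
        rwa [h3] at h1
      have hpos : 0 < ‖(↑v⁻¹ : X →L[ℂ] X)‖ := Units.norm_pos v⁻¹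
      refine ⟨v.ofNearby (S + algebraMap ℂ (X →L[ℂ] X) t) ?_, rfl⟩
      have h4 : S + algebraMap ℂ (X →L[ℂ] X) t - v =
          algebraMap ℂ (X →L[ℂ] X) ((-(1 / (2 * K)) : ℝ) : ℂ) := by
        rw [hv, add_sub_add_left_eq_sub, ← map_sub]
        congr 1
        push_cast
        ring
      rw [h4, norm_algebraMap', Complex.norm_real, norm_neg, Real.norm_of_nonneg hd.le]
      calc 1 / (2 * K) < K⁻¹ := by
            rw [← one_div]
            exact one_div_lt_one_div_of_lt hK (by linarith)
        _ ≤ _ := inv_anti₀ hpos hvinv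
  obtain ⟨n, hn⟩ := exists_nat_gt ((‖S‖ + 1) / (1 / (2 * K)))
  have h0 := hstep n 0 le_rfl (by
    rw [div_lt_iff₀ (by positivity)] at hn
    linarith)
  simpa using h0

variable {A : Type*} [CStarAlgebra A] [PartialOrder A]
  {E : Type*} [NormedAddCommGroup E] [NormedSpace ℂ E] [Module A E] [CStarModule A E]

theorem norm_smul_le_mul (a : A) (x : E) : ‖a • x‖ ≤ ‖a‖ * ‖x‖ := by
  refine abs_le_of_sq_le_sq' ?_ (by positivity) |>.2
  rw [CStarModule.norm_sq_eq A, CStarModule.inner_op_smul_right, CStarModule.inner_op_smul_left,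
    mul_pow, CStarModule.norm_sq_eq A (x := x)]
  calc _ ≤ ‖a‖ * (‖⟪x, x⟫_A‖ * ‖star a‖) :=
        (norm_mul_le _ _).trans (mul_le_mul_of_nonneg_left (norm_mul_le _ _) (norm_nonneg _))
    _ = _ := by rw [norm_star]; ring

variable [StarOrderedRing A] {ι : Type*} [Fintype ι]

theorem norm_le_sqrt_norm_sum_mul_star (b : ι → A) (i : ι) :
    ‖b i‖ ≤ √‖∑ j, b j * star (b j)‖ := by
  rw [Real.le_sqrt (norm_nonneg _) (norm_nonneg _), sq, ← CStarRing.norm_self_mul_star]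
  exact CStarAlgebra.norm_le_norm_of_nonneg_of_le (mul_star_self_nonneg _)
    (Finset.single_le_sum (f := fun j => b j * star (b j))
      (fun j _ => mul_star_self_nonneg _) (Finset.mem_univ i))

/-- Coefficients of size at most `c * ‖y‖` for `y` in terms of the `x i` bound `‖y‖` by the
coefficients `⟪x i, y⟫` of the frame operator. -/
theorem sq_norm_le_of_sum_smul_eq {x : ι → E} {y : E} {a : ι → A} (hy : ∑ i, a i • x i = y)
    {c : ℝ} (ha : ∀ i, ‖a i‖ ≤ c * ‖y‖) :
    ‖y‖ ^ 2 ≤ (c * Fintype.card ι) ^ 2 * ‖∑ i, ⟪x i, y⟫_A * star ⟪x i, y⟫_A‖ := by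
  set g := ‖∑ i, ⟪x i, y⟫_A * star ⟪x i, y⟫_A‖
  -- Only one slot of `⟪y, y⟫` is expanded, so the factor `‖y‖` from `ha` cancels later.
  have h1 : ‖y‖ * ‖y‖ ≤ ‖y‖ * (c * Fintype.card ι * √g) := by
    calc ‖y‖ * ‖y‖ = ‖⟪y, ∑ i, a i • x i⟫_A‖ := by rw [hy, ← sq, CStarModule.norm_sq_eq A]
      _ = ‖∑ i, a i * ⟪y, x i⟫_A‖ := by
        simp only [CStarModule.inner_sum_right, CStarModule.inner_op_smul_right]
      _ ≤ ∑ i, c * ‖y‖ * √g := by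
        refine norm_sum_le_of_le _ fun i _ => (norm_mul_le _ _).trans ?_
        have h2 : ‖⟪y, x i⟫_A‖ ≤ √g := by
          rw [← CStarModule.star_inner, norm_star]
          exact norm_le_sqrt_norm_sum_mul_star (fun j => ⟪x j, y⟫_A) i
        exact mul_le_mul (ha i) h2 (norm_nonneg _) ((norm_nonneg _).trans (ha i))
      _ = _ := by simp; ring
  rcases eq_or_ne y 0 with h0 | h0
  · rw [h0, norm_zero, zero_pow two_ne_zero]
    positivity
  · have h2 := le_of_mul_le_mul_left h1 (norm_pos_iff.2 h0)
    calc ‖y‖ ^ 2 ≤ (c * Fintype.card ι * √g) ^ 2 := pow_le_pow_left₀ (norm_nonneg _) h2 2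
      _ = _ := by rw [mul_pow, Real.sq_sqrt (norm_nonneg _)]

variable [IsScalarTower ℂ A E] [CompleteSpace E]

/-- A closed finitely generated submodule of a Hilbert module is projective. -/
theorem projective_of_isClosed_of_fg (N : Submodule A E) (hc : IsClosed (N : Set E)) (hfg : N.FG) :
    Module.Projective A N := by
  have : CompleteSpace N := hc.completeSpace_coe
  have : Module.Finite A N := .of_fg hfg
  obtain ⟨n, x, hx⟩ := Submodule.fg_iff_exists_fin_generating_family.1
    (Module.Finite.fg_top (R := A) (M := N))
  have hsmul (z : N) : Continuous fun a : A => a • z := by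
    refine AddMonoidHomClass.continuous_of_bound (LinearMap.toSpanSingleton A N z) ‖z‖ fun a => ?_
    rw [mul_comm]
    exact norm_smul_le_mul a (z : E)
  let T : (Fin n → A) →L[ℂ] N :=
    ⟨(Fintype.linearCombination A x).restrictScalars ℂ, by
      change Continuous fun a : Fin n → A => ∑ i, a i • x i
      exact continuous_finsetSum _ fun i _ => (hsmul (x i)).comp (continuous_apply i)⟩
  have hT : Function.Surjective T := by
    change Function.Surjective (Fintype.linearCombination A x)
    rw [← LinearMap.range_eq_top, Fintype.range_linearCombination, hx]
  let V : N →ₗ[A] (Fin n → A) :=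
    { toFun := fun y i => ⟪(x i : E), (y : E)⟫_A
      map_add' := fun y z => by ext; simp
      map_smul' := fun a y => by ext; simp }
  let S : N →L[ℂ] N :=
    ⟨(Fintype.linearCombination A x ∘ₗ V).restrictScalars ℂ, by
      refine T.continuous.comp (continuous_pi fun i => ?_)
      exact ((CStarModule.innerSL (A := A) (x i : E)).continuous).comp continuous_subtype_val⟩
  -- Open mapping theorem: every `y` has coefficients of size at most `c * ‖y‖`.
  obtain ⟨c, hc0, hcb⟩ := T.exists_preimage_norm_le hT
  have hS : IsUnit S := by
    -- `(c * n) ^ 2` is the frame bound; the `+ 1` only keeps the constant positive.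
    refine isUnit_of_forall_add_smul_bounded_below S (K := (c * n) ^ 2 + 1) (by positivity)
      fun t ht y => ?_
    obtain ⟨a, hay, hac⟩ := hcb y
    have h1 := sq_norm_le_of_sum_smul_eq (x := fun i => (x i : E)) (y := (y : E)) (a := a) (c := c)
      (by rw [← hay]; simp [T, Fintype.linearCombination_apply])
      (fun i => (norm_le_pi_norm a i).trans hac)
    rw [Fintype.card_fin] at h1
    set g := ∑ i, ⟪(x i : E), (y : E)⟫_A * star ⟪(x i : E), (y : E)⟫_A with hg
    -- Both summands are nonnegative in `A`, so the norm is at least `‖g‖` whatever `t ≥ 0` is.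
    have h2 : ⟪(y : E), ((S y + (t : ℂ) • y : N) : E)⟫_A = g + t • ⟪(y : E), (y : E)⟫_A := by
      have h3 : ((S y : N) : E) = ∑ i, ⟪(x i : E), (y : E)⟫_A • (x i : E) := by
        simp [S, V, Fintype.linearCombination_apply]
      rw [Submodule.coe_add, h3, Submodule.coe_smul_of_tower,
        CStarModule.inner_add_right,
        CStarModule.inner_smul_right_complex, CStarModule.inner_sum_right, Complex.coe_smul, hg]
      simp only [CStarModule.inner_op_smul_right, CStarModule.star_inner]
    have h3 : ‖g‖ ≤ ‖y‖ * ‖S y + (t : ℂ) • y‖ := by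
      refine le_trans ?_ (CStarModule.norm_inner_le (A := A) E
        (x := (y : E)) (y := ((S y + (t : ℂ) • y : N) : E)))
      rw [h2]
      refine CStarAlgebra.norm_le_norm_of_nonneg_of_le
        (Finset.sum_nonneg fun i _ => mul_star_self_nonneg _) ?_
      exact le_add_of_nonneg_right (smul_nonneg ht CStarModule.inner_self_nonneg)
    rcases eq_or_ne y 0 with h0 | h0
    · rw [h0, norm_zero]
      positivity
    have h4 : ‖y‖ * ‖y‖ ≤ ‖y‖ * (((c * n) ^ 2 + 1) * ‖S y + (t : ℂ) • y‖) := by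
      have h5 : ‖y‖ ^ 2 ≤ (c * n) ^ 2 * ‖g‖ := h1
      nlinarith [mul_le_mul_of_nonneg_left h3 (sq_nonneg (c * n)), norm_nonneg g]
    exact le_of_mul_le_mul_left h4 (norm_pos_iff.2 h0)
  obtain ⟨v, hv⟩ := hS
  have hbij : Function.Bijective (Fintype.linearCombination A x ∘ₗ V) := by
    change Function.Bijective S
    rw [← hv]
    exact (ContinuousLinearEquiv.unitsEquiv ℂ N v).bijective
  let e : N ≃ₗ[A] N := LinearEquiv.ofBijective _ hbij
  -- With `e` the frame operator, `V ∘ e⁻¹` is a section of `Aⁿ → N`.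
  refine Module.Projective.of_split (V ∘ₗ e.symm.toLinearMap) (Fintype.linearCombination A x) ?_
  ext1 y
  exact e.apply_symm_apply y

end Projective

/-! ### Classes in `K(A)` -/

section KGroup

variable {A : Type u} [Ring A] {M N P : Type u} [AddCommGroup M] [Module A M]
  [AddCommGroup N] [Module A N] [AddCommGroup P] [Module A P]

theorem KGroup.mk_add_mk (hM : IsFGProjective A M) (hN : IsFGProjective A N)
    (hP : IsFGProjective A P) (e : P ≃ₗ[A] M × N) :
    KGroup.mk hP = KGroup.mk hM + KGroup.mk hN := by
  unfold KGroup.mk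
  rw [← map_add]
  congr 1
  exact Quotient.sound ⟨e⟩

/-- A surjection onto a projective module splits off its kernel. -/
noncomputable def kerProdEquivOfRightInverse (f : P →ₗ[A] N) (s : N →ₗ[A] P)
    (h : ∀ y, f (s y) = y) : P ≃ₗ[A] LinearMap.ker f × N where
  toFun x := (⟨x - s (f x), by simp [h]⟩, f x)
  map_add' x y := by ext <;> simp; abel
  map_smul' a x := by ext <;> simp [smul_sub]
  invFun z := z.1 + s z.2
  left_inv x := by simp
  right_inv z := by ext <;> simp [h]

/-- The kernel is a direct summand of `P`, which is why its finite generation and projectivity are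
conclusions. Allowing any model `M` of the kernel lets two different maps share one. -/
theorem KGroup.mk_sub_mk_of_surjective (f : P →ₗ[A] N) (hf : Function.Surjective f)
    (hP : IsFGProjective A P) (hN : IsFGProjective A N) (e : LinearMap.ker f ≃ₗ[A] M) :
    ∃ hM : IsFGProjective A M, KGroup.mk hP - KGroup.mk hN = KGroup.mk hM := by
  have := hP.finite
  have := hP.projective
  have := hN.projective
  obtain ⟨s, hs⟩ := f.exists_rightInverse_of_surjective (LinearMap.range_eq_top.2 hf)
  let E : P ≃ₗ[A] M × N := (kerProdEquivOfRightInverse f s (LinearMap.congr_fun hs)).trans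
    (e.prodCongr (LinearEquiv.refl A N))
  have hM : IsFGProjective A M :=
    ⟨Module.Finite.of_surjective (LinearMap.fst A M N ∘ₗ E.toLinearMap)
      (Prod.fst_surjective.comp E.surjective),
    Module.Projective.of_split (E.symm.toLinearMap ∘ₗ LinearMap.inl A M N)
      (LinearMap.fst A M N ∘ₗ E.toLinearMap) (by ext; simp)⟩
  exact ⟨hM, by rw [KGroup.mk_add_mk hM hN hP E, add_sub_cancel_right]⟩

end KGroup

/-! ### Upper semi-Fredholm decompositions -/

namespace IsUpperDecomposition

variable {A : Type u} [CStarAlgebra A] [PartialOrder A] [StarOrderedRing A]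
  {F : StandardModule A →L[A] StandardModule A}
  {M₁ N₁ M₂ N₂ : Submodule A (StandardModule A)}

theorem apply_mem (h : IsUpperDecomposition F M₁ N₁ M₂ N₂) {x : StandardModule A} (hx : x ∈ M₁) :
    F x ∈ M₂ := by
  obtain ⟨e, he⟩ := h.iso
  rw [← he ⟨x, hx⟩]
  exact (e _).2

/-- If `F x ∈ N₂` then the component of `x` in `M₁` vanishes. -/
theorem mem_of_apply_mem (h : IsUpperDecomposition F M₁ N₁ M₂ N₂) {x : StandardModule A}
    (hx : F x ∈ N₂) : x ∈ N₁ := by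
  obtain ⟨m, hm, n, hn, rfl⟩ := Submodule.mem_sup.1
    (h.isCompl_dom.sup_eq_top ▸ Submodule.mem_top : x ∈ M₁ ⊔ N₁)
  have h1 : F m ∈ N₂ := by
    have := N₂.sub_mem hx (h.mapsTo n hn)
    rwa [map_add, add_sub_cancel_right] at this
  have h2 : F m = 0 := Submodule.disjoint_def.1 h.isCompl_cod.disjoint _ (h.apply_mem hm) h1
  obtain ⟨e, he⟩ := h.iso
  have h3 : e ⟨m, hm⟩ = 0 := Subtype.ext ((he _).trans h2)
  have h4 : m = 0 := congrArg Subtype.val ((map_eq_zero_iff e e.injective).1 h3)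
  rwa [h4, zero_add]

/-- This exhibits the image as an intersection of sets that are closed once `ran F` is. -/
theorem image_eq (h : IsUpperDecomposition F M₁ N₁ M₂ N₂) :
    F '' N₁ = Set.range F ∩ N₂ := by
  ext y
  constructor
  · rintro ⟨x, hx, rfl⟩
    exact ⟨⟨x, rfl⟩, h.mapsTo x hx⟩
  · rintro ⟨⟨x, rfl⟩, hx⟩
    exact ⟨x, h.mem_of_apply_mem hx, rfl⟩

theorem isClosed_image (h : IsUpperDecomposition F M₁ N₁ M₂ N₂) (hran : IsClosed (Set.range F)) :
    IsClosed (F '' N₁) :=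
  h.image_eq ▸ hran.inter h.isClosed_N₂

theorem isFGProjective (h : IsUpperDecomposition F M₁ N₁ M₂ N₂) : IsFGProjective A N₁ :=
  ⟨.of_fg h.fg, projective_of_isClosed_of_fg N₁ h.isClosed_N₁ h.fg⟩

theorem isFGProjective_map (h : IsUpperDecomposition F M₁ N₁ M₂ N₂)
    (hran : IsClosed (Set.range F)) : IsFGProjective A (N₁.map F.toLinearMap) :=
  ⟨.of_fg (h.fg.map _),
    projective_of_isClosed_of_fg _ (h.isClosed_image hran) (h.fg.map _)⟩

/-- The kernel of `F` on `N₁` is the whole kernel of `F`. -/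
noncomputable def kerEquiv (h : IsUpperDecomposition F M₁ N₁ M₂ N₂) :
    LinearMap.ker (F.toLinearMap.submoduleMap N₁) ≃ₗ[A] LinearMap.ker F.toLinearMap where
  toFun x := ⟨x, congrArg Subtype.val x.2⟩
  map_add' _ _ := rfl
  map_smul' _ _ := rfl
  invFun x := ⟨⟨x, h.mem_of_apply_mem (by
    rw [show F x = 0 from x.2]
    exact N₂.zero_mem)⟩, Subtype.ext x.2⟩
  left_inv _ := rfl
  right_inv _ := rfl

/-- The index `[N₁] - [F(N₁)]` is the class of `ker F`. -/
theorem mk_sub_mk_eq (h : IsUpperDecomposition F M₁ N₁ M₂ N₂) (hran : IsClosed (Set.range F)) :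
    ∃ hK : IsFGProjective A (LinearMap.ker F.toLinearMap),
      KGroup.mk h.isFGProjective - KGroup.mk (h.isFGProjective_map hran) = KGroup.mk hK :=
  KGroup.mk_sub_mk_of_surjective _ (F.toLinearMap.submoduleMap_surjective N₁) _ _ h.kerEquiv

end IsUpperDecomposition

end HilbertModule

theorem lemma2p20 {A : Type u} [CStarAlgebra A] [PartialOrder A] [StarOrderedRing A]
    (F : HilbertModule.StandardModule A →L[A] HilbertModule.StandardModule A)
    (hF : F ∈ HilbertModule.MPhiPlus A)
    (hran : IsClosed (Set.range F))
    (M₁ N₁ M₂ N₂ M₁' N₁' M₂' N₂' : Submodule A (HilbertModule.StandardModule A))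
    (hdec : HilbertModule.IsUpperDecomposition F M₁ N₁ M₂ N₂)
    (hdec' : HilbertModule.IsUpperDecomposition F M₁' N₁' M₂' N₂') :
    IsClosed (F '' N₁) ∧ IsClosed (F '' N₁') ∧
    ∃ (hN : HilbertModule.IsFGProjective A N₁)
      (hFN : HilbertModule.IsFGProjective A (N₁.map F.toLinearMap))
      (hN' : HilbertModule.IsFGProjective A N₁')
      (hFN' : HilbertModule.IsFGProjective A (N₁'.map F.toLinearMap)),
      HilbertModule.KGroup.mk hN - HilbertModule.KGroup.mk hFN =
        HilbertModule.KGroup.mk hN' - HilbertModule.KGroup.mk hFN' := by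
  -- The two proofs that `ker F` is finitely generated projective agree by proof irrelevance, so
  -- both differences equal the same class.
  obtain ⟨_, h⟩ := hdec.mk_sub_mk_eq hran
  obtain ⟨_, h'⟩ := hdec'.mk_sub_mk_eq hran
  exact ⟨hdec.isClosed_image hran, hdec'.isClosed_image hran, hdec.isFGProjective,
    hdec.isFGProjective_map hran, hdec'.isFGProjective, hdec'.isFGProjective_map hran,
    h.trans h'.symm⟩
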